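/- For a word $x=x_1\cdots x_n$ of nonnegative integers let $\mathrm{asc}(x)$ be the number of indices $j<n$ with $x_j<x_{j+1}$. The word $x$ is an ascent sequence if $x_1=0$ (when $n\ge 1$) and $x_i\le \mathrm{asc}(x_1\cdots x_{i-1})+1$ for $1<i\le n$. A word contains a pattern $p$ if some subsequence of it is order-isomorphic to $p$, and avoids $p$ otherwise. Let $\mathcal A_{101,120}(n)$ be the set of ascent sequences of length $n$ avoiding both $101$ and $120$, and let $\mathcal S_{231,4123}(n)$ be the set of permutations of length $n$ avoiding both $231$ and $4123$ (the empty word being the only element for $n=0$). Proposition. (a) For every $n\ge 0$ there is a bijection between $\mathcal A_{101,120}(n)$ and $\mathcal S_{231,4123}(n)$. (b) Arrange $\bigcup_{n\ge1}\mathcal A_{101,120}(n)$ as a tree with root $0$, in which the children of $x$ are the members of $\mathcal A_{101,120}(n+1)$ obtained by appending one letter to the end of $x\in\mathcal A_{101,120}(n)$. Arrange $\bigcup_{n\ge1}\mathcal S_{231,4123}(n)$ as a tree with root $1$, in which the children of $\sigma$ are the members of $\mathcal S_{231,4123}(n+1)$ obtained by inserting the new maximum $n+1$ into $\sigma\in\mathcal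 S_{231,4123}(n)$. The nodes of both trees can be labelled with the four labels $(0),(01),(010),(0102)$ so that both are generating trees with root label $(0)$ and succession rules $$(0)\leadsto(0)(01),\quad (01)\leadsto(01)(01)(010),\quad (010)\leadsto(010)(0102),\quad (0102)\leadsto(01)(0102),$$ where the right-hand side lists, with multiplicity, the labels of the children of a node with the label on the left. In the first tree the ascent sequences $0$, $01$, $010$, $0102$ carry the labels $(0),(01),(010),(0102)$, respectively. The two labelled trees are isomorphic. (c) As formal power series, $$\sum_{n\ge0}|\mathcal A_{101,120}(n)|\,x^n=\sum_{n\ge0}|\mathcal S_{231,4123}(n)|\,x^n=\frac{(x-1)^3}{3x^3-5x^2+4x-1}.$$ -/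

import Mathlib

/-- The word `x` contains the pattern `p`: some subsequence of `x` is order-isomorphic to `p`. -/
def ContainsPattern {α : Type} [LT α] {n : ℕ} (x : Fin n → α) (p : List ℕ) : Prop :=
  ∃ f : Fin p.length ↪o Fin n, ∀ i j, x (f i) < x (f j) ↔ p.get i < p.get j

/-- The word `x` avoids all patterns of the list `B`. -/
def AvoidsPatterns {α : Type} [LT α] {n : ℕ} (x : Fin n → α) (B : List (List ℕ)) : Prop :=
  ∀ p ∈ B, ¬ ContainsPattern x p

/-- The number of ascents of a word. -/
def asc {n : ℕ} (x : Fin n → ℕ) : ℕ :=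
  (Finset.univ.filter fun j : Fin n => ∃ h : (j : ℕ) + 1 < n, x j < x ⟨(j : ℕ) + 1, h⟩).card

/-- Ascent sequences: the first letter is `0`, and every other letter is at most one more than
the number of ascents of the word formed by the letters before it. -/
def IsAscentSeq {n : ℕ} (x : Fin n → ℕ) : Prop :=
  ∀ i : Fin n, ((i : ℕ) = 0 → x i = 0) ∧
    (0 < (i : ℕ) → x i ≤ asc (fun j : Fin (i : ℕ) => x (Fin.castLE i.isLt.le j)) + 1)

/-- The set of ascent sequences of length `n` that avoid all patterns of `B`. -/
def avoidingAscentSeqs (B : List (List ℕ)) (n : ℕ) : Set (Fin n → ℕ) :=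
  {x | IsAscentSeq x ∧ AvoidsPatterns x B}

/-- The set of permutations of length `n` (in one-line notation `σ 0, …, σ (n - 1)`) that avoid
all patterns of `B`. -/
def avoidingPerms (B : List (List ℕ)) (n : ℕ) : Set (Equiv.Perm (Fin n)) :=
  {σ | AvoidsPatterns (σ : Fin n → Fin n) B}

/-- The permutation `τ` of length `n + 1` arises from `σ` by inserting a new maximum at some
position. -/
def IsMaxInsertion {n : ℕ} (σ : Equiv.Perm (Fin n)) (τ : Equiv.Perm (Fin (n + 1))) : Prop :=
  ∃ p : Fin (n + 1), τ p = Fin.last n ∧ ∀ i : Fin n, τ (p.succAbove i) = (σ i).castSucc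

/-- Nodes arranged in levels, with a child relation from each level to the next one. -/
structure LevelGraph where
  Node : ℕ → Type
  IsChild : {n : ℕ} → Node n → Node (n + 1) → Prop

/-- Avoiding ascent sequences, level `n` consisting of those of length `n + 1`; the children of
`x` arise by appending one letter to the end of `x`. -/
def ascentTree (B : List (List ℕ)) : LevelGraph where
  Node n := avoidingAscentSeqs B (n + 1)
  IsChild x y := ∃ a : ℕ, y.1 = Fin.snoc (α := fun _ => ℕ) x.1 a

/-- Avoiding permutations, level `n` consisting of those of length `n + 1`; the children of `σ`
arise by inserting a new maximum into `σ`. -/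
def permTree (B : List (List ℕ)) : LevelGraph where
  Node n := avoidingPerms B (n + 1)
  IsChild σ τ := IsMaxInsertion σ.1 τ.1

/-- A root label and succession rules: for each label the multiset of the labels of the
children. -/
structure SuccessionRules (Λ : Type) where
  root : Λ
  children : Λ → Multiset Λ

/-- A labelling of the nodes of a level graph. -/
abbrev LevelGraph.Labelling (T : LevelGraph) (Λ : Type) : Type := (n : ℕ) → T.Node n → Λ

/-- `T`, with the labelling `lab`, is a rooted tree that is generated by the root label and the
succession rules `S`. -/
structure IsGeneratingTree {Λ : Type} [DecidableEq Λ] (T : LevelGraph) (S : SuccessionRules Λ)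
    (lab : T.Labelling Λ) : Prop where
  exists_root : ∃ r : T.Node 0, lab 0 r = S.root ∧ ∀ s : T.Node 0, s = r
  exists_parent : ∀ (n : ℕ) (w : T.Node (n + 1)), ∃! v : T.Node n, T.IsChild v w
  children_labels : ∀ (n : ℕ) (v : T.Node n) (l : Λ),
    Set.encard {w : T.Node (n + 1) | T.IsChild v w ∧ lab (n + 1) w = l} =
      ((S.children (lab n v)).count l : ℕ∞)

/-- An isomorphism of labelled level graphs. -/
structure LabelledIso {Λ : Type} (T U : LevelGraph) (labT : T.Labelling Λ)
    (labU : U.Labelling Λ) where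
  toEquiv : (n : ℕ) → T.Node n ≃ U.Node n
  isChild_iff : ∀ (n : ℕ) (v : T.Node n) (w : T.Node (n + 1)),
    T.IsChild v w ↔ U.IsChild (toEquiv n v) (toEquiv (n + 1) w)
  label_eq : ∀ (n : ℕ) (v : T.Node n), labU n (toEquiv n v) = labT n v

/-- The four labels `(0)`, `(01)`, `(010)`, `(0102)`. -/
inductive TreeLabel where
  | l0 | l01 | l010 | l0102
  deriving DecidableEq

/-- Root `(0)` and the rules `(0) ⇝ (0)(01)`, `(01) ⇝ (01)(01)(010)`, `(010) ⇝ (010)(0102)`,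
`(0102) ⇝ (01)(0102)`. -/
def fourLabelRules : SuccessionRules TreeLabel where
  root := .l0
  children
    | .l0 => {.l0, .l01}
    | .l01 => {.l01, .l01, .l010}
    | .l010 => {.l010, .l0102}
    | .l0102 => {.l01, .l0102}

/-! In both families the possible ways to add one letter depend on one of four states, and the state
of the enlarged object is determined by the old state and the choice made. So both trees obey the
same rules. The rules alone give the isomorphism (`nonempty_labelledIso`) and the counting
(`powerSeries_eq_of_fourLabelRules`).

For ascent sequences the maximum `m` equals the number of ascents, and only `m - 1`, `m`, `m + 1`
can be appended. Which of them are allowed is the state, kept in `AscentState` and followed by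
`append_max`, `append_succ` and `append_pred`.

For permutations a new maximum can only play the 3 of 231 or the 4 of 4123. It may therefore enter
at a site exactly when all entries to the left are below all entries to the right and no 123 lies to
the right. `isActiveSite_insertMax_iff` tells which sites survive an insertion: the new end, and the
old sites up to the new maximum from which the entries decrease up to it. The states in `PermState`
record the sites and whether the stretches between them decrease. -/

namespace IsGeneratingTree

/-! ### Generating trees: isomorphism and counting from the rules alone -/

variable {Λ : Type} [DecidableEq Λ] {T U : LevelGraph} {S : SuccessionRules Λ}
  {labT : T.Labelling Λ} {labU : U.Labelling Λ}

/-- The parent of a node. -/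
noncomputable def parent (hT : IsGeneratingTree T S labT) {n : ℕ} (w : T.Node (n + 1)) :
    T.Node n :=
  (hT.exists_parent n w).choose

theorem isChild_iff_parent_eq (hT : IsGeneratingTree T S labT) {n : ℕ} (v : T.Node n)
    (w : T.Node (n + 1)) : T.IsChild v w ↔ hT.parent w = v := by
  have h := (hT.exists_parent n w).choose_spec
  constructor
  · intro hv
    exact (h.2 v hv).symm
  · rintro rfl
    exact h.1

theorem encard_fiber (hT : IsGeneratingTree T S labT) {n : ℕ} (v : T.Node n) (l : Λ) :
    Set.encard {w : T.Node (n + 1) | hT.parent w = v ∧ labT (n + 1) w = l} =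
      ((S.children (labT n v)).count l : ℕ∞) := by
  rw [← hT.children_labels n v l]
  simp only [hT.isChild_iff_parent_eq]

/-- Finiteness comes for free because the rules prescribe an extended cardinality; `Nat.card` would
not exclude infinite fibers. -/
theorem finite_fiber (hT : IsGeneratingTree T S labT) {n : ℕ} (v : T.Node n) (l : Λ) :
    Finite {w : T.Node (n + 1) // hT.parent w = v ∧ labT (n + 1) w = l} :=
  Set.finite_of_encard_eq_coe (hT.encard_fiber v l)

theorem card_fiber (hT : IsGeneratingTree T S labT) {n : ℕ} (v : T.Node n) (l : Λ) :
    Nat.card {w : T.Node (n + 1) // hT.parent w = v ∧ labT (n + 1) w = l} =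
      (S.children (labT n v)).count l := by
  have h := congrArg ENat.toNat (hT.encard_fiber v l)
  rw [ENat.toNat_natCast] at h
  exact h

theorem exists_equiv_succ (hT : IsGeneratingTree T S labT) (hU : IsGeneratingTree U S labU)
    {n : ℕ} (e : T.Node n ≃ U.Node n) (he : ∀ v, labU n (e v) = labT n v) :
    ∃ e' : T.Node (n + 1) ≃ U.Node (n + 1), (∀ w, labU (n + 1) (e' w) = labT (n + 1) w) ∧
      ∀ v w, T.IsChild v w ↔ U.IsChild (e v) (e' w) := by
  let f : T.Node (n + 1) → U.Node n × Λ := fun w => (e (hT.parent w), labT (n + 1) w)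
  let g : U.Node (n + 1) → U.Node n × Λ := fun w => (hU.parent w, labU (n + 1) w)
  -- Corresponding parents carry the same label, so the rules give their children of each label the
  -- same finite number. Matching these fibers respects parents and labels at once.
  have hfg : ∀ c, Nonempty ({w // f w = c} ≃ {w // g w = c}) := by
    rintro ⟨u, l⟩
    obtain ⟨v, rfl⟩ := e.surjective u
    have := hT.finite_fiber v l
    have := hU.finite_fiber (e v) l
    have hcard : Nat.card {w : T.Node (n + 1) // hT.parent w = v ∧ labT (n + 1) w = l} =
        Nat.card {w : U.Node (n + 1) // hU.parent w = e v ∧ labU (n + 1) w = l} := by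
      rw [card_fiber, card_fiber, he]
    refine ⟨((Equiv.subtypeEquivRight fun w => ?_).trans (Finite.card_eq.1 hcard).some).trans
      (Equiv.subtypeEquivRight fun w => ?_)⟩ <;> simp [f, g]
  let e' := Equiv.ofFiberEquiv fun c => (hfg c).some
  have he' : ∀ w, g (e' w) = f w := fun w => Equiv.ofFiberEquiv_map _ w
  refine ⟨e', fun w => (Prod.ext_iff.1 (he' w)).2, fun v w => ?_⟩
  have h : hU.parent (e' w) = e (hT.parent w) := (Prod.ext_iff.1 (he' w)).1
  rw [isChild_iff_parent_eq hT, isChild_iff_parent_eq hU, h, e.apply_eq_iff_eq]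

theorem nonempty_labelledIso (hT : IsGeneratingTree T S labT)
    (hU : IsGeneratingTree U S labU) : Nonempty (LabelledIso T U labT labU) := by
  obtain ⟨r, hr, hr'⟩ := hT.exists_root
  obtain ⟨s, hs, hs'⟩ := hU.exists_root
  -- Each level's equivalence is chosen from that of the level below, so compatibility with the
  -- child relation is what the choice at each successor guarantees.
  let E : (n : ℕ) → {e : T.Node n ≃ U.Node n // ∀ v, labU n (e v) = labT n v} := fun n =>
    Nat.rec ⟨⟨fun _ => s, fun _ => r, fun v => (hr' v).symm, fun v => (hs' v).symm⟩,
        fun v => by rw [hr' v, hr]; exact hs⟩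
      (fun _ e => ⟨(exists_equiv_succ hT hU e.1 e.2).choose,
        (exists_equiv_succ hT hU e.1 e.2).choose_spec.1⟩) n
  exact ⟨⟨fun n => (E n).1, fun n => (exists_equiv_succ hT hU (E n).1 (E n).2).choose_spec.2,
    fun n => (E n).2⟩⟩

theorem finite_node [Finite Λ] (hT : IsGeneratingTree T S labT) (n : ℕ) : Finite (T.Node n) := by
  induction n with
  | zero =>
    obtain ⟨r, -, hr⟩ := hT.exists_root
    have : Subsingleton (T.Node 0) := ⟨fun a b => (hr a).trans (hr b).symm⟩
    infer_instance
  | succ n ih =>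
    have hfib : ∀ c : T.Node n × Λ,
        Finite {w : T.Node (n + 1) // (hT.parent w, labT (n + 1) w) = c} := by
      rintro ⟨v, l⟩
      have := hT.finite_fiber v l
      simpa only [Prod.mk.injEq] using this
    exact Finite.of_equiv _
      (Equiv.sigmaFiberEquiv fun w : T.Node (n + 1) => (hT.parent w, labT (n + 1) w))

theorem card_label_zero (hT : IsGeneratingTree T S labT) (l : Λ) :
    Nat.card {v : T.Node 0 // labT 0 v = l} = if S.root = l then 1 else 0 := by
  obtain ⟨r, hr, hr'⟩ := hT.exists_root
  split_ifs with h
  · rw [Nat.card_eq_one_iff_unique]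
    exact ⟨⟨fun a b => Subtype.ext ((hr' a).trans (hr' b).symm)⟩, ⟨r, hr.trans h⟩⟩
  · have : IsEmpty {v : T.Node 0 // labT 0 v = l} :=
      ⟨fun a => h (by rw [← hr, ← hr' a.1]; exact a.2)⟩
    exact Nat.card_of_isEmpty

/-- The transfer-matrix step: sort the nodes of label `l` by parent, then the parents by label. -/
theorem card_label_succ [Fintype Λ] (hT : IsGeneratingTree T S labT) (n : ℕ) (l : Λ) :
    Nat.card {w : T.Node (n + 1) // labT (n + 1) w = l} =
      ∑ k, Nat.card {v : T.Node n // labT n v = k} * (S.children k).count l := by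
  have := hT.finite_node n
  have := Fintype.ofFinite (T.Node n)
  have hfib : ∀ v, Finite {w : {w : T.Node (n + 1) // labT (n + 1) w = l} // hT.parent w.1 = v} :=
    fun v => by
      have := hT.finite_node (n + 1)
      infer_instance
  have hcard : ∀ v, Nat.card {w : {w : T.Node (n + 1) // labT (n + 1) w = l} //
      hT.parent w.1 = v} = (S.children (labT n v)).count l := fun v => by
    rw [← hT.card_fiber v l]
    refine Nat.card_congr ((Equiv.subtypeSubtypeEquivSubtypeInter _ fun w => hT.parent w = v).trans
      (Equiv.subtypeEquivRight fun w => and_comm))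
  rw [← Nat.card_congr (Equiv.sigmaFiberEquiv fun w : {w : T.Node (n + 1) //
    labT (n + 1) w = l} => hT.parent w.1), Nat.card_sigma]
  simp_rw [hcard]
  rw [← Finset.sum_fiberwise (g := labT n)]
  refine Finset.sum_congr rfl fun k _ => ?_
  rw [Finset.sum_congr rfl (g := fun _ => (S.children k).count l)
    fun v hv => by rw [(Finset.mem_filter.1 hv).2], Finset.sum_const, smul_eq_mul,
    Nat.card_eq_fintype_card, Fintype.card_subtype]

theorem card_node [Fintype Λ] (hT : IsGeneratingTree T S labT) (n : ℕ) :
    Nat.card (T.Node n) = ∑ k, Nat.card {v : T.Node n // labT n v = k} := by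
  have := hT.finite_node n
  rw [← Nat.card_congr (Equiv.sigmaFiberEquiv (labT n)), Nat.card_sigma]

/-- A labelling is a generating tree as soon as a functional relation between nodes and labels
holds at the root and is propagated along complete lists of children. -/
theorem of_relation (Q : (n : ℕ) → T.Node n → Λ → Prop)
    (hQ : ∀ n v l, Q n v l → labT n v = l)
    (hroot : ∃ r : T.Node 0, Q 0 r S.root ∧ ∀ s : T.Node 0, s = r)
    (hparent : ∀ (n : ℕ) (w : T.Node (n + 1)), ∃! v : T.Node n, T.IsChild v w)
    (hstep : ∀ n v l, Q n v l → ∃ L : List (T.Node (n + 1)), L.Nodup ∧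
      (∀ w, T.IsChild v w ↔ w ∈ L) ∧ (∀ w ∈ L, Q (n + 1) w (labT (n + 1) w)) ∧
      (L.map (labT (n + 1)) : Multiset Λ) = S.children l) :
    IsGeneratingTree T S labT := by
  -- Every node above level zero is a child, so propagation along complete lists of children reaches
  -- the whole tree.
  have hall : ∀ n v, Q n v (labT n v) := by
    intro n
    induction n with
    | zero =>
      obtain ⟨r, hr, hr'⟩ := hroot
      intro v
      rw [hr' v, hQ _ _ _ hr]
      exact hr
    | succ n ih =>
      intro w
      obtain ⟨v, hv, -⟩ := hparent n w
      obtain ⟨L, -, hL, hL', -⟩ := hstep n v _ (ih v)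
      exact hL' w ((hL w).1 hv)
  refine ⟨?_, hparent, fun n v l => ?_⟩
  · obtain ⟨r, hr, hr'⟩ := hroot
    exact ⟨r, hQ _ _ _ hr, hr'⟩
  · classical
    obtain ⟨L, hnd, hL, -, hmap⟩ := hstep n v _ (hall n v)
    have hset : {w : T.Node (n + 1) | T.IsChild v w ∧ labT (n + 1) w = l} =
        ((L.toFinset.filter fun w => labT (n + 1) w = l : Finset _) : Set _) := by
      ext w
      simp [hL]
    rw [hset, Set.encard_coe_eq_coe_finsetCard, ← hmap, Multiset.coe_count, Nat.cast_inj,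
      List.count_eq_countP, List.countP_map, List.countP_eq_length_filter,
      ← List.toFinset_card_of_nodup (hnd.filter _)]
    congr 1
    ext w
    simp

end IsGeneratingTree

/-! ### The generating function of the four-label rules -/

instance : Fintype TreeLabel :=
  ⟨{.l0, .l01, .l010, .l0102}, fun l => by cases l <;> decide⟩

theorem TreeLabel.sum_eq (f : TreeLabel → ℕ) :
    ∑ l, f l = f .l0 + f .l01 + f .l010 + f .l0102 := by
  change ∑ l ∈ {TreeLabel.l0, .l01, .l010, .l0102}, f l = _
  simp [add_assoc]

theorem powerSeries_eq_of_fourLabelRules {T : LevelGraph} {lab : T.Labelling TreeLabel}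
    (hT : IsGeneratingTree T fourLabelRules lab) (F : ℕ → ℕ) (h0 : F 0 = 1)
    (hF : ∀ n, F (n + 1) = Nat.card (T.Node n)) :
    (PowerSeries.mk fun n => (F n : ℚ)) = (PowerSeries.X - 1) ^ 3 *
      (3 * PowerSeries.X ^ 3 - 5 * PowerSeries.X ^ 2 + 4 * PowerSeries.X - 1)⁻¹ := by
  let c : ℕ → TreeLabel → ℕ := fun n l => Nat.card {v : T.Node n // lab n v = l}
  have hz : ∀ l, c 0 l = if TreeLabel.l0 = l then 1 else 0 := hT.card_label_zero
  have hs : ∀ n l, c (n + 1) l = ∑ k, c n k * (fourLabelRules.children k).count l :=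
    hT.card_label_succ
  have hc : ∀ n, F (n + 1) = ∑ k, c n k := fun n => (hF n).trans (hT.card_node n)
  have s0 : ∀ n, c (n + 1) .l0 = c n .l0 := fun n => by
    rw [hs, TreeLabel.sum_eq]; simp [fourLabelRules]
  have s1 : ∀ n, c (n + 1) .l01 = c n .l0 + 2 * c n .l01 + c n .l0102 := fun n => by
    rw [hs, TreeLabel.sum_eq]; simp [fourLabelRules]; ring
  have s2 : ∀ n, c (n + 1) .l010 = c n .l01 + c n .l010 := fun n => by
    rw [hs, TreeLabel.sum_eq]; simp [fourLabelRules]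
  have s3 : ∀ n, c (n + 1) .l0102 = c n .l010 + c n .l0102 := fun n => by
    rw [hs, TreeLabel.sum_eq]; simp [fourLabelRules]
  have f1 : F 1 = 1 := by simp [hc, hz]
  have f2 : F 2 = 2 := by simp [hc, TreeLabel.sum_eq, hz, s0, s1, s2, s3]
  have f3 : F 3 = 5 := by simp [hc, TreeLabel.sum_eq, hz, s0, s1, s2, s3]
  -- The transfer matrix has characteristic polynomial `(t - 1)(t^3 - 4t^2 + 5t - 3)`, but the total
  -- count already satisfies the cubic factor. The recurrence starts only at `F 1`; the values from
  -- `F 0` to `F 3` account for the cubic numerator.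
  have hrec : ∀ n, F (n + 4) + 5 * F (n + 2) = 4 * F (n + 3) + 3 * F (n + 1) := fun n => by
    simp only [hc, TreeLabel.sum_eq, s0, s1, s2, s3]; ring
  rw [PowerSeries.eq_mul_inv_iff_mul_eq (by simp)]
  have hX : (PowerSeries.mk fun n => (F n : ℚ)) *
      (3 * PowerSeries.X ^ 3 - 5 * PowerSeries.X ^ 2 + 4 * PowerSeries.X - 1) =
      PowerSeries.C 3 * ((PowerSeries.mk fun n => (F n : ℚ)) * PowerSeries.X ^ 3) -
      PowerSeries.C 5 * ((PowerSeries.mk fun n => (F n : ℚ)) * PowerSeries.X ^ 2) +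
      PowerSeries.C 4 * ((PowerSeries.mk fun n => (F n : ℚ)) * PowerSeries.X ^ 1) -
      (PowerSeries.mk fun n => (F n : ℚ)) := by
    simp only [map_ofNat]; ring
  have hY : ((PowerSeries.X : PowerSeries ℚ) - 1) ^ 3 = PowerSeries.X ^ 3 -
      PowerSeries.C 3 * PowerSeries.X ^ 2 + PowerSeries.C 3 * PowerSeries.X ^ 1 - 1 := by
    simp only [map_ofNat]; ring
  rw [hX, hY]
  ext n
  simp only [map_sub, map_add, PowerSeries.coeff_C_mul, PowerSeries.coeff_mul_X_pow',
    PowerSeries.coeff_mk, PowerSeries.coeff_X_pow, PowerSeries.coeff_one]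
  match n with
  | 0 => simp [h0]
  | 1 => simp [h0, f1]; norm_num
  | 2 => simp [h0, f1, f2]; norm_num
  | 3 => simp [h0, f1, f2, f3]; norm_num
  | n + 4 =>
    have := congrArg (Nat.cast (R := ℚ)) (hrec n)
    push_cast at this
    simp
    linarith

/-! ### Pattern containment in terms of indices -/

section Patterns

variable {α : Type} [LinearOrder α] {n : ℕ}

/-- `ContainsPattern` compares letters by `<` only; equality of the outer two letters arises because
neither is below the other. -/
theorem containsPattern_101_iff (x : Fin n → α) :
    ContainsPattern x [1, 0, 1] ↔ ∃ i j k, i < j ∧ j < k ∧ x j < x i ∧ x i = x k := by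
  constructor
  · rintro ⟨f, hf⟩
    refine ⟨f ⟨0, by simp⟩, f ⟨1, by simp⟩, f ⟨2, by simp⟩, by simp, by simp, ?_, ?_⟩
    · exact (hf _ _).2 (by simp)
    · exact le_antisymm (not_lt.1 fun h => by simpa using (hf _ _).1 h)
        (not_lt.1 fun h => by simpa using (hf _ _).1 h)
  · rintro ⟨i, j, k, hij, hjk, h1, h2⟩
    refine ⟨OrderEmbedding.ofStrictMono (![i, j, k] : Fin 3 → Fin n) ?_, ?_⟩
    · rw [Fin.strictMono_iff_lt_succ]
      intro a
      fin_cases a <;> assumption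
    · change ∀ a b : Fin 3, x (![i, j, k] a) < x (![i, j, k] b) ↔ _
      simp [Fin.forall_fin_succ, h1, h1.le, ← h2]

theorem containsPattern_120_iff (x : Fin n → α) :
    ContainsPattern x [1, 2, 0] ↔ ∃ i j k, i < j ∧ j < k ∧ x k < x i ∧ x i < x j := by
  constructor
  · rintro ⟨f, hf⟩
    refine ⟨f ⟨0, by simp⟩, f ⟨1, by simp⟩, f ⟨2, by simp⟩, by simp, by simp, ?_, ?_⟩
    all_goals exact (hf _ _).2 (by simp)
  · rintro ⟨i, j, k, hij, hjk, h1, h2⟩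
    refine ⟨OrderEmbedding.ofStrictMono (![i, j, k] : Fin 3 → Fin n) ?_, ?_⟩
    · rw [Fin.strictMono_iff_lt_succ]
      intro a
      fin_cases a <;> assumption
    · change ∀ a b : Fin 3, x (![i, j, k] a) < x (![i, j, k] b) ↔ _
      simp [Fin.forall_fin_succ, h1, h2, h1.le, h2.not_gt, h1.trans h2, (h1.trans h2).le]

theorem containsPattern_231_iff (x : Fin n → α) :
    ContainsPattern x [2, 3, 1] ↔ ∃ i j k, i < j ∧ j < k ∧ x k < x i ∧ x i < x j := by
  constructor
  · rintro ⟨f, hf⟩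
    refine ⟨f ⟨0, by simp⟩, f ⟨1, by simp⟩, f ⟨2, by simp⟩, by simp, by simp, ?_, ?_⟩
    all_goals exact (hf _ _).2 (by simp)
  · rintro ⟨i, j, k, hij, hjk, h1, h2⟩
    refine ⟨OrderEmbedding.ofStrictMono (![i, j, k] : Fin 3 → Fin n) ?_, ?_⟩
    · rw [Fin.strictMono_iff_lt_succ]
      intro a
      fin_cases a <;> assumption
    · change ∀ a b : Fin 3, x (![i, j, k] a) < x (![i, j, k] b) ↔ _
      simp [Fin.forall_fin_succ, h1, h2, h1.le, h2.not_gt, h1.trans h2, (h1.trans h2).le]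

theorem containsPattern_4123_iff (x : Fin n → α) :
    ContainsPattern x [4, 1, 2, 3] ↔
      ∃ i j k l, i < j ∧ j < k ∧ k < l ∧ x j < x k ∧ x k < x l ∧ x l < x i := by
  constructor
  · rintro ⟨f, hf⟩
    refine ⟨f ⟨0, by simp⟩, f ⟨1, by simp⟩, f ⟨2, by simp⟩, f ⟨3, by simp⟩, by simp, by simp,
      by simp, ?_, ?_, ?_⟩
    all_goals exact (hf _ _).2 (by simp)
  · rintro ⟨i, j, k, l, hij, hjk, hkl, h1, h2, h3⟩
    refine ⟨OrderEmbedding.ofStrictMono (![i, j, k, l] : Fin 4 → Fin n) ?_, ?_⟩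
    · rw [Fin.strictMono_iff_lt_succ]
      intro a
      fin_cases a <;> assumption
    · change ∀ a b : Fin 4, x (![i, j, k, l] a) < x (![i, j, k, l] b) ↔ _
      simp [Fin.forall_fin_succ, h1, h2, h3, h1.not_gt, h2.not_gt, h3.not_gt, h1.trans h2,
        (h1.trans h2).not_gt, h2.trans h3, (h2.trans h3).not_gt, (h1.trans h2).trans h3,
        ((h1.trans h2).trans h3).not_gt]

end Patterns

/-! ### Appending a letter to an ascent sequence -/

section Snoc

/-- Appending a letter to a word. -/
def appendLetter {n : ℕ} (x : Fin n → ℕ) (a : ℕ) : Fin (n + 1) → ℕ :=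
  Fin.snoc (α := fun _ => ℕ) x a

@[simp]
theorem appendLetter_castSucc {n : ℕ} (x : Fin n → ℕ) (a : ℕ) (i : Fin n) :
    appendLetter x a i.castSucc = x i :=
  Fin.snoc_castSucc (α := fun _ => ℕ) a x i

@[simp]
theorem appendLetter_last {n : ℕ} (x : Fin n → ℕ) (a : ℕ) :
    appendLetter x a (Fin.last n) = a :=
  Fin.snoc_last (α := fun _ => ℕ) a x

theorem asc_appendLetter {n : ℕ} (x : Fin (n + 1) → ℕ) (a : ℕ) :
    asc (appendLetter x a) = asc x + if x (Fin.last n) < a then 1 else 0 := by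
  simp only [asc, Finset.card_filter]
  -- The last index of a word never starts an ascent. Splitting two indices off the longer word and
  -- one off `x` isolates the only possible new ascent.
  rw [Fin.sum_univ_castSucc, Fin.sum_univ_castSucc, Fin.sum_univ_castSucc (n := n)]
  have h1 : ∀ j : Fin n, (∃ h : (j.castSucc.castSucc : ℕ) + 1 < n + 1 + 1,
      appendLetter x a j.castSucc.castSucc < appendLetter x a ⟨j.castSucc.castSucc + 1, h⟩) ↔
      ∃ h : (j.castSucc : ℕ) + 1 < n + 1, x j.castSucc < x ⟨j.castSucc + 1, h⟩ := by
    intro j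
    have hj : (⟨(j : ℕ) + 1, by omega⟩ : Fin (n + 1 + 1)) = j.succ.castSucc := rfl
    have hj' : (⟨(j : ℕ) + 1, by omega⟩ : Fin (n + 1)) = j.succ := rfl
    simp [hj, hj', -Fin.castSucc_succ]
  have h2 : (∃ h : ((Fin.last n).castSucc : ℕ) + 1 < n + 1 + 1,
      appendLetter x a (Fin.last n).castSucc < appendLetter x a ⟨(Fin.last n).castSucc + 1, h⟩) ↔
      x (Fin.last n) < a := by
    have hj : (⟨n + 1, by omega⟩ : Fin (n + 1 + 1)) = Fin.last (n + 1) := rfl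
    simp [hj]
  simp only [h1, h2]
  simp

theorem isAscentSeq_appendLetter_iff {n : ℕ} (x : Fin (n + 1) → ℕ) (a : ℕ) :
    IsAscentSeq (appendLetter x a) ↔ IsAscentSeq x ∧ a ≤ asc x + 1 := by
  rw [IsAscentSeq, Fin.forall_fin_succ']
  refine and_congr (forall_congr' fun i => ?_) ?_
  · have h : (fun j : Fin (i.castSucc : ℕ) =>
        appendLetter x a (Fin.castLE i.castSucc.isLt.le j)) =
        fun j : Fin (i : ℕ) => x (Fin.castLE i.isLt.le j) := by
      funext j
      exact appendLetter_castSucc x a (Fin.castLE i.isLt.le j)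
    rw [h]
    simp
  · have h : (fun j : Fin (Fin.last (n + 1) : ℕ) =>
        appendLetter x a (Fin.castLE (Fin.last (n + 1)).isLt.le j)) = x := by
      funext j
      exact appendLetter_castSucc x a j
    rw [h]
    simp

/-- The letter `a` can be appended to the ascent sequence `x` that avoids `101` and `120`. -/
structure IsAllowedLetter {n : ℕ} (x : Fin n → ℕ) (a : ℕ) : Prop where
  le : a ≤ asc x + 1
  no101 : ∀ i j, i < j → x j < x i → x i ≠ a
  no120 : ∀ i j, i < j → a < x i → x j ≤ x i

theorem mem_avoidingAscentSeqs_iff {n : ℕ} (x : Fin n → ℕ) :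
    x ∈ avoidingAscentSeqs [[1, 0, 1], [1, 2, 0]] n ↔ IsAscentSeq x ∧
      (∀ i j k, i < j → j < k → x j < x i → x i ≠ x k) ∧
      ∀ i j k, i < j → j < k → x k < x i → x j ≤ x i := by
  simp [avoidingAscentSeqs, AvoidsPatterns, containsPattern_101_iff, containsPattern_120_iff]
  grind

theorem appendLetter_mem_iff {n : ℕ} (x : Fin (n + 1) → ℕ) (a : ℕ) :
    appendLetter x a ∈ avoidingAscentSeqs [[1, 0, 1], [1, 2, 0]] (n + 2) ↔
      x ∈ avoidingAscentSeqs [[1, 0, 1], [1, 2, 0]] (n + 1) ∧ IsAllowedLetter x a := by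
  rw [mem_avoidingAscentSeqs_iff, mem_avoidingAscentSeqs_iff, isAscentSeq_appendLetter_iff]
  have hl : ∀ i : Fin (n + 1), ¬ Fin.last (n + 1) < i.castSucc := fun i => (Fin.le_last _).not_gt
  simp only [Fin.forall_fin_succ' (n := n + 1), appendLetter_castSucc, appendLetter_last,
    Fin.castSucc_lt_castSucc_iff, Fin.castSucc_lt_last, hl, lt_self_iff_false,
    false_imp_iff, true_imp_iff, implies_true, and_true]
  constructor
  · rintro ⟨⟨h1, h2⟩, h3, h4⟩
    exact ⟨⟨h1, fun i j => (h3 i j).1, fun i j => (h4 i j).1⟩, h2, fun i j => (h3 i j).2,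
      fun i j => (h4 i j).2⟩
  · rintro ⟨⟨h1, h3, h4⟩, h2, h5, h6⟩
    exact ⟨⟨h1, h2⟩, fun i j => ⟨h3 i j, h5 i j⟩, fun i j => ⟨h4 i j, h6 i j⟩⟩

/-- The last two conditions are the new ones: there `a` acts as the 0 of 101 or as the 2 of 120,
with `b` as the final letter. -/
theorem isAllowedLetter_appendLetter_iff {n : ℕ} (x : Fin (n + 1) → ℕ) (a b : ℕ) :
    IsAllowedLetter (appendLetter x a) b ↔ b ≤ asc (appendLetter x a) + 1 ∧
      (∀ i j, i < j → x j < x i → x i ≠ b) ∧ (∀ i j, i < j → b < x i → x j ≤ x i) ∧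
      (∀ i, a < x i → x i ≠ b) ∧ ∀ i, b < x i → a ≤ x i := by
  have hl : ∀ i : Fin (n + 1), ¬ Fin.last (n + 1) < i.castSucc := fun i => (Fin.le_last _).not_gt
  have : IsAllowedLetter (appendLetter x a) b ↔ b ≤ asc (appendLetter x a) + 1 ∧
      (∀ i j, i < j → appendLetter x a j < appendLetter x a i → appendLetter x a i ≠ b) ∧
      (∀ i j, i < j → b < appendLetter x a i → appendLetter x a j ≤ appendLetter x a i) :=
    ⟨fun h => ⟨h.1, h.2, h.3⟩, fun h => ⟨h.1, h.2.1, h.2.2⟩⟩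
  rw [this]
  simp only [Fin.forall_fin_succ' (n := n + 1), appendLetter_castSucc, appendLetter_last,
    Fin.castSucc_lt_castSucc_iff, Fin.castSucc_lt_last, hl, lt_self_iff_false,
    false_imp_iff, true_imp_iff, implies_true, and_true]
  constructor
  · rintro ⟨h1, h3, h4⟩
    exact ⟨h1, fun i j => (h3 i).1 j, fun i j => (h4 i).1 j, fun i => (h3 i).2, fun i => (h4 i).2⟩
  · rintro ⟨h1, h3, h4, h5, h6⟩
    exact ⟨h1, fun i => ⟨h3 i, h5 i⟩, fun i => ⟨h4 i, h6 i⟩⟩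

end Snoc

/-! ### The four states of an ascent sequence -/

/-- The letters that can be appended to a word with maximum `m` and the given label. -/
def TreeLabel.Allows (l : TreeLabel) (m b : ℕ) : Prop :=
  match l with
  | .l0 => m = 0 ∧ (b = m ∨ b = m + 1)
  | .l01 => b + 1 = m ∨ b = m ∨ b = m + 1
  | .l010 => b + 1 = m ∨ b = m + 1
  | .l0102 => b = m ∨ b = m + 1

/-- A word with label `l` whose maximum and number of ascents are both `m`. -/
structure AscentState {n : ℕ} (x : Fin (n + 1) → ℕ) (l : TreeLabel) (m : ℕ) : Prop where
  asc_eq : asc x = m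
  le : ∀ i, x i ≤ m
  exists_eq : ∃ i, x i = m
  pos_iff : 0 < m ↔ l ≠ .l0
  last_eq : x (Fin.last n) = if l = .l010 then m - 1 else m
  allowed_iff : ∀ b, IsAllowedLetter x b ↔ l.Allows m b

open Classical in
/-- The label of an ascent sequence that avoids `101` and `120`. -/
noncomputable def ascentLabel {n : ℕ} (x : Fin (n + 1) → ℕ) : TreeLabel :=
  if asc x = 0 then .l0 else if x (Fin.last n) < asc x then .l010
  else if IsAllowedLetter x (asc x - 1) then .l01 else .l0102

namespace AscentState

variable {n m : ℕ} {x : Fin (n + 1) → ℕ} {l : TreeLabel}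

theorem ascentLabel_eq (h : AscentState x l m) : ascentLabel x = l := by
  have h1 := h.pos_iff
  have h2 := h.last_eq
  rw [ascentLabel, h.allowed_iff, h.asc_eq, h2]
  cases l <;> simp [TreeLabel.Allows] at * <;> grind

/-- Another `m` after a final `m` changes nothing: it makes no ascent, and allowed letters are at
least `m - 1`, so the only letters it could precede in a 120 as its 1 are already equal to `m`. -/
theorem append_max (h : AscentState x l m) (hl : l ≠ .l010) :
    AscentState (appendLetter x m) l m := by
  obtain ⟨h1, h2, h3, h4, h5, h6⟩ := h
  rw [if_neg hl] at h5
  have ha : asc (appendLetter x m) = m := by rw [asc_appendLetter, h1, h5]; simp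
  refine ⟨ha, ?_, ⟨Fin.last _, by simp⟩, h4, by simp [hl], fun b => ?_⟩
  · simpa [Fin.forall_fin_succ' (n := n + 1)] using h2
  · rw [isAllowedLetter_appendLetter_iff, ha, ← h6 b]
    constructor
    · rintro ⟨g1, g2, g3, -, -⟩
      exact ⟨h1 ▸ g1, g2, g3⟩
    · intro g
      refine ⟨h1 ▸ g.le, g.no101, g.no120, fun i hi => absurd (h2 i) hi.not_ge, fun i hi => ?_⟩
      have := h2 i
      have := (h6 b).1 g
      cases l <;> simp only [TreeLabel.Allows] at this hl <;> grind

theorem append_succ (h : AscentState x l m) :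
    AscentState (appendLetter x (m + 1))
      (match l with | .l0 => .l01 | .l01 => .l01 | .l010 => .l0102 | .l0102 => .l01) (m + 1) := by
  obtain ⟨h1, h2, h3, h4, h5, h6⟩ := h
  have hlast := h2 (Fin.last n)
  have ha : asc (appendLetter x (m + 1)) = m + 1 := by
    rw [asc_appendLetter, h1, if_pos (by omega)]
  refine ⟨ha, ?_, ⟨Fin.last _, by simp⟩, ?_, ?_, fun b => ?_⟩
  · simpa [Fin.forall_fin_succ' (n := n + 1)] using
      fun i => (h2 i).trans (Nat.le_succ m)
  · cases l <;> simp
  · cases l <;> simp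
  · have key : IsAllowedLetter (appendLetter x (m + 1)) b ↔
        b = m + 2 ∨ (m ≤ b ∧ IsAllowedLetter x b) := by
      rw [isAllowedLetter_appendLetter_iff, ha]
      constructor
      · rintro ⟨g1, g2, g3, g4, g5⟩
        by_cases hb : b = m + 2
        · exact .inl hb
        · refine .inr ⟨?_, by omega, g2, g3⟩
          obtain ⟨i, hi⟩ := h3
          by_contra hlt
          have := g5 i (by omega)
          omega
      · rintro (rfl | ⟨hb, g⟩)
        · exact ⟨le_rfl, fun i _ _ _ => by have := h2 i; omega,
            fun i _ _ _ => by have := h2 i; omega, fun i _ => by have := h2 i; omega,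
            fun i _ => by have := h2 i; omega⟩
        · exact ⟨by have := g.le; omega, g.no101, g.no120,
            fun i _ => by have := h2 i; omega, fun i _ => by have := h2 i; omega⟩
    rw [key, h6]
    cases l <;> simp only [TreeLabel.Allows] at h4 ⊢ <;> grind

theorem append_pred (h : AscentState x l m) (hl : l = .l01 ∨ l = .l010) :
    AscentState (appendLetter x (m - 1)) .l010 m := by
  obtain ⟨h1, h2, h3, h4, h5, h6⟩ := h
  have hm : 0 < m := h4.2 (by rintro rfl; simp at hl)
  have ha : asc (appendLetter x (m - 1)) = m := by
    rw [asc_appendLetter, h1, h5, if_neg (by split_ifs <;> omega)]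
    rfl
  obtain ⟨i, hi⟩ := h3
  refine ⟨ha, ?_, ⟨i.castSucc, by rw [appendLetter_castSucc, hi]⟩, by simpa,
    by simp, fun b => ?_⟩
  · simpa [Fin.forall_fin_succ' (n := n + 1)] using h2
  · have key : IsAllowedLetter (appendLetter x (m - 1)) b ↔ b ≠ m ∧ IsAllowedLetter x b := by
      rw [isAllowedLetter_appendLetter_iff, ha]
      constructor
      · rintro ⟨g1, g2, g3, g4, g5⟩
        refine ⟨?_, by omega, g2, g3⟩
        rintro rfl
        exact g4 i (by omega) hi
      · rintro ⟨hb, g⟩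
        refine ⟨h1 ▸ g.le, g.no101, g.no120, fun j hj => by have := h2 j; omega, fun j hj => ?_⟩
        have := (h6 b).1 g
        rcases hl with rfl | rfl <;> simp [TreeLabel.Allows] at this <;> omega
    rw [key, h6]
    rcases hl with rfl | rfl <;> simp [TreeLabel.Allows] <;> omega

end AscentState

theorem ascentState_zero : AscentState ![0] .l0 0 := by
  have ha : asc ![0] = 0 := by decide
  refine ⟨ha, by simp, ⟨0, rfl⟩, by simp, rfl, fun b => ?_⟩
  have hlt : ∀ i j : Fin 1, ¬ i < j := by decide
  constructor
  · intro h
    have := ha ▸ h.le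
    change 0 = 0 ∧ (b = 0 ∨ b = 0 + 1)
    omega
  · intro h
    simp only [TreeLabel.Allows] at h
    exact ⟨by omega, fun i j hij => absurd hij (hlt i j), fun i j hij => absurd hij (hlt i j)⟩

theorem exists_unique_parent_ascentTree (n : ℕ)
    (w : (ascentTree [[1, 0, 1], [1, 2, 0]]).Node (n + 1)) :
    ∃! v, (ascentTree [[1, 0, 1], [1, 2, 0]]).IsChild v w := by
  obtain ⟨w, hw⟩ := w
  have hsnoc : w = appendLetter (Fin.init (α := fun _ => ℕ) w) (w (Fin.last _)) :=
    (Fin.snoc_init_self (α := fun _ => ℕ) w).symm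
  have hmem := ((appendLetter_mem_iff _ _).1 (hsnoc ▸ hw)).1
  refine ⟨⟨_, hmem⟩, ⟨w (Fin.last _), hsnoc⟩, ?_⟩
  rintro ⟨v, hv⟩ ⟨a, rfl : w = appendLetter v a⟩
  exact Subtype.ext (Fin.init_snoc (α := fun _ => ℕ) a v).symm

/-- Turns a duplicate-free list of the allowed letters into the list of children that
`IsGeneratingTree.of_relation` asks for. -/
theorem exists_children_ascentTree {n : ℕ} (v : (ascentTree [[1, 0, 1], [1, 2, 0]]).Node n)
    (A : List ℕ) (hA : A.Nodup) (hv : ∀ a, IsAllowedLetter v.1 a ↔ a ∈ A)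
    (hQ : ∀ a ∈ A, ∃ l m, AscentState (appendLetter v.1 a) l m) :
    ∃ L : List ((ascentTree [[1, 0, 1], [1, 2, 0]]).Node (n + 1)), L.Nodup ∧
      (∀ w, (ascentTree [[1, 0, 1], [1, 2, 0]]).IsChild v w ↔ w ∈ L) ∧
      (∀ w ∈ L, ∃ m, AscentState w.1 (ascentLabel w.1) m) ∧
      L.map (fun w => ascentLabel w.1) = A.map fun a => ascentLabel (appendLetter v.1 a) := by
  have hmem : ∀ a ∈ A, appendLetter v.1 a ∈ avoidingAscentSeqs [[1, 0, 1], [1, 2, 0]] (n + 2) :=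
    fun a ha => (appendLetter_mem_iff _ _).2 ⟨v.2, (hv a).2 ha⟩
  refine ⟨A.pmap (fun a ha => ⟨appendLetter v.1 a, ha⟩) hmem, ?_, ?_, ?_, ?_⟩
  · refine hA.pmap fun a _ b _ hab => ?_
    have := congrFun (Subtype.ext_iff.1 hab) (Fin.last _)
    simpa using this
  · rintro ⟨w, hw⟩
    refine Iff.trans ?_ List.mem_pmap.symm
    constructor
    · rintro ⟨a, rfl : w = appendLetter v.1 a⟩
      exact ⟨a, (hv a).1 ((appendLetter_mem_iff _ _).1 hw).2, rfl⟩
    · rintro ⟨a, _, ha⟩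
      exact ⟨a, (Subtype.ext_iff.1 ha).symm⟩
  · intro w hw
    obtain ⟨a, ha, rfl⟩ := List.mem_pmap.1 hw
    obtain ⟨l, m, h⟩ := hQ a ha
    exact ⟨m, by rwa [h.ascentLabel_eq]⟩
  · exact (List.map_pmap ..).trans
      (List.pmap_eq_map (f := fun a => ascentLabel (appendLetter v.1 a)) hmem)

theorem zero_mem_avoidingAscentSeqs :
    ![0] ∈ avoidingAscentSeqs [[1, 0, 1], [1, 2, 0]] 1 := by
  have hlt : ∀ i j : Fin 1, ¬ i < j := by decide
  rw [mem_avoidingAscentSeqs_iff]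
  refine ⟨fun i => ⟨fun _ => by simp, fun h => by omega⟩, ?_, ?_⟩
  all_goals intro i j k hij; exact absurd hij (hlt i j)

theorem isGeneratingTree_ascentTree :
    IsGeneratingTree (ascentTree [[1, 0, 1], [1, 2, 0]]) fourLabelRules
      fun _ v => ascentLabel v.1 := by
  refine IsGeneratingTree.of_relation (fun n v l => ∃ m, AscentState v.1 l m)
    (fun n v l ⟨m, h⟩ => h.ascentLabel_eq) ?_ exists_unique_parent_ascentTree ?_
  · refine ⟨⟨![0], zero_mem_avoidingAscentSeqs⟩, ⟨0, ascentState_zero⟩, ?_⟩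
    rintro ⟨s, hs⟩
    refine Subtype.ext (funext fun i : Fin 1 => ?_)
    rw [Subsingleton.elim i 0]
    exact (hs.1 0).1 rfl
  · rintro n v l ⟨m, h⟩
    have hsucc := h.append_succ
    have hpos := h.pos_iff
    match l with
    | .l0 =>
      have hmax := h.append_max (by simp)
      obtain ⟨L, h1, h2, h3, h4⟩ := exists_children_ascentTree v [m, m + 1] (by simp)
        (fun a => by
          rw [h.allowed_iff]
          simp [TreeLabel.Allows] at hpos ⊢
          omega)
        (by simpa using ⟨⟨_, _, hmax⟩, _, _, hsucc⟩)
      refine ⟨L, h1, h2, h3, ?_⟩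
      rw [h4, List.map_cons, List.map_cons, hmax.ascentLabel_eq, hsucc.ascentLabel_eq]
      rfl
    | .l01 =>
      have hmax := h.append_max (by simp)
      have hpred := h.append_pred (by simp)
      -- The letters are listed in the order in which the rule lists the resulting labels, so that
      -- the final multiset equality holds by `rfl`.
      obtain ⟨L, h1, h2, h3, h4⟩ := exists_children_ascentTree v [m, m + 1, m - 1]
        (by simp at hpos ⊢; omega)
        (fun a => by
          rw [h.allowed_iff]
          simp [TreeLabel.Allows] at hpos ⊢
          omega)
        (by simpa using ⟨⟨_, _, hmax⟩, ⟨_, _, hsucc⟩, _, _, hpred⟩)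
      refine ⟨L, h1, h2, h3, ?_⟩
      rw [h4, List.map_cons, List.map_cons, List.map_cons, hmax.ascentLabel_eq,
        hsucc.ascentLabel_eq, hpred.ascentLabel_eq]
      rfl
    | .l010 =>
      have hpred := h.append_pred (by simp)
      obtain ⟨L, h1, h2, h3, h4⟩ := exists_children_ascentTree v [m - 1, m + 1]
        (by simp)
        (fun a => by
          rw [h.allowed_iff]
          simp [TreeLabel.Allows] at hpos ⊢
          omega)
        (by simpa using ⟨⟨_, _, hpred⟩, _, _, hsucc⟩)
      refine ⟨L, h1, h2, h3, ?_⟩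
      rw [h4, List.map_cons, List.map_cons, hpred.ascentLabel_eq, hsucc.ascentLabel_eq]
      rfl
    | .l0102 =>
      have hmax := h.append_max (by simp)
      obtain ⟨L, h1, h2, h3, h4⟩ := exists_children_ascentTree v [m + 1, m] (by simp)
        (fun a => by
          rw [h.allowed_iff]
          simp [TreeLabel.Allows] at hpos ⊢
          omega)
        (by simpa using ⟨⟨_, _, hsucc⟩, _, _, hmax⟩)
      refine ⟨L, h1, h2, h3, ?_⟩
      rw [h4, List.map_cons, List.map_cons, hmax.ascentLabel_eq, hsucc.ascentLabel_eq]
      rfl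

theorem AscentState.append_mem {n m : ℕ} {x : Fin (n + 1) → ℕ} {l : TreeLabel}
    (h : AscentState x l m) (hx : x ∈ avoidingAscentSeqs [[1, 0, 1], [1, 2, 0]] (n + 1)) {a : ℕ}
    (ha : l.Allows m a) :
    appendLetter x a ∈ avoidingAscentSeqs [[1, 0, 1], [1, 2, 0]] (n + 2) :=
  (appendLetter_mem_iff _ _).2 ⟨hx, (h.allowed_iff a).2 ha⟩

theorem exists_ascentLabel_eq :
    (∃ x : avoidingAscentSeqs [[1, 0, 1], [1, 2, 0]] 1,
      x.1 = ![0] ∧ ascentLabel x.1 = .l0) ∧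
    (∃ x : avoidingAscentSeqs [[1, 0, 1], [1, 2, 0]] 2,
      x.1 = ![0, 1] ∧ ascentLabel x.1 = .l01) ∧
    (∃ x : avoidingAscentSeqs [[1, 0, 1], [1, 2, 0]] 3,
      x.1 = ![0, 1, 0] ∧ ascentLabel x.1 = .l010) ∧
    (∃ x : avoidingAscentSeqs [[1, 0, 1], [1, 2, 0]] 4,
      x.1 = ![0, 1, 0, 2] ∧ ascentLabel x.1 = .l0102) := by
  have h0 := ascentState_zero
  have m0 := zero_mem_avoidingAscentSeqs
  have h1 := h0.append_succ
  have m1 := h0.append_mem m0 (a := 0 + 1) (by simp [TreeLabel.Allows])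
  have h2 := h1.append_pred (by simp)
  have m2 := h1.append_mem m1 (a := 0 + 1 - 1) (by simp [TreeLabel.Allows])
  have h3 := h2.append_succ
  have m3 := h2.append_mem m2 (a := 0 + 1 + 1) (by simp [TreeLabel.Allows])
  refine ⟨⟨⟨_, m0⟩, rfl, h0.ascentLabel_eq⟩, ⟨⟨_, m1⟩, ?_, h1.ascentLabel_eq⟩,
    ⟨⟨_, m2⟩, ?_, h2.ascentLabel_eq⟩, ⟨⟨_, m3⟩, ?_, h3.ascentLabel_eq⟩⟩
  all_goals
    funext i
    fin_cases i <;> rfl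

/-! ### Inserting a new maximum into a permutation -/

/-- The permutation that arises from `σ` by inserting a new maximum at position `p`. -/
def insertMax {n : ℕ} (σ : Equiv.Perm (Fin n)) (p : Fin (n + 1)) : Equiv.Perm (Fin (n + 1)) :=
  ((finSuccEquiv' p).trans σ.optionCongr).trans (finSuccEquiv' (Fin.last n)).symm

section InsertMax

variable {n : ℕ} (σ : Equiv.Perm (Fin n)) (p : Fin (n + 1))

@[simp]
theorem insertMax_self : insertMax σ p p = Fin.last n := by
  simp [insertMax]

@[simp]
theorem insertMax_succAbove (i : Fin n) : insertMax σ p (p.succAbove i) = (σ i).castSucc := by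
  simp [insertMax]

theorem insertMax_eq_iff (τ : Equiv.Perm (Fin (n + 1))) :
    τ = insertMax σ p ↔ τ p = Fin.last n ∧ ∀ i, τ (p.succAbove i) = (σ i).castSucc := by
  constructor
  · rintro rfl
    simp
  · rintro ⟨h1, h2⟩
    ext x : 1
    induction x using Fin.succAboveCases p with
    | x => simp [h1]
    | p i => simp [h2]

theorem isMaxInsertion_iff (τ : Equiv.Perm (Fin (n + 1))) :
    IsMaxInsertion σ τ ↔ ∃ p, τ = insertMax σ p := by
  simp only [IsMaxInsertion, insertMax_eq_iff]

theorem insertMax_inj {σ σ' : Equiv.Perm (Fin n)} {p p' : Fin (n + 1)} :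
    insertMax σ p = insertMax σ' p' ↔ σ = σ' ∧ p = p' := by
  constructor
  · intro h
    have hp : p = p' := by
      apply (insertMax σ p).injective
      rw [insertMax_self, h, insertMax_self]
    subst hp
    refine ⟨?_, rfl⟩
    ext i : 1
    have := congrArg (fun τ : Equiv.Perm _ => τ (p.succAbove i)) h
    simpa using this
  · rintro ⟨rfl, rfl⟩
    rfl

theorem exists_eq_insertMax (τ : Equiv.Perm (Fin (n + 1))) : ∃ σ p, τ = insertMax σ p := by
  let p := τ.symm (Fin.last n)
  have hp : τ p = Fin.last n := τ.apply_symm_apply _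
  have hne : ∀ i, τ (p.succAbove i) ≠ Fin.last n := fun i h =>
    Fin.succAbove_ne p i (τ.injective (h.trans hp.symm))
  let f : Fin n → Fin n := fun i => (τ (p.succAbove i)).castPred (hne i)
  have hf : Function.Injective f := fun i j hij =>
    Fin.succAbove_right_injective (τ.injective (Fin.castPred_inj.1 hij))
  refine ⟨Equiv.ofBijective f (Finite.injective_iff_bijective.1 hf), p, ?_⟩
  rw [insertMax_eq_iff]
  exact ⟨hp, fun i => by simp [f]⟩

end InsertMax

/-! ### Active sites and how an insertion changes them -/

/-- The entries of `σ` at the positions from `q` up to, but excluding, `p` decrease. -/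
def IsDecreasingOn {n : ℕ} (σ : Equiv.Perm (Fin n)) (q p : ℕ) : Prop :=
  ∀ i j : Fin n, q ≤ i → i < j → (j : ℕ) < p → σ j ≤ σ i

/-- Inserting a new maximum at position `q` preserves avoidance of `231` and `4123`. -/
structure IsActiveSite {n : ℕ} (σ : Equiv.Perm (Fin n)) (q : ℕ) : Prop where
  le : q ≤ n
  cut : ∀ i j : Fin n, (i : ℕ) < q → q ≤ j → σ i ≤ σ j
  no123 : ∀ i j k : Fin n, q ≤ i → i < j → j < k → σ i < σ j → σ k ≤ σ j

theorem isActiveSite_iff {n : ℕ} (σ : Equiv.Perm (Fin n)) (q : ℕ) :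
    IsActiveSite σ q ↔ q ≤ n ∧ (∀ i j : Fin n, (i : ℕ) < q → q ≤ j → σ i ≤ σ j) ∧
      ∀ i j k : Fin n, q ≤ i → i < j → j < k → σ i < σ j → σ k ≤ σ j :=
  ⟨fun h => ⟨h.1, h.2, h.3⟩, fun h => ⟨h.1, h.2.1, h.2.2⟩⟩

theorem mem_avoidingPerms_iff {n : ℕ} (σ : Equiv.Perm (Fin n)) :
    σ ∈ avoidingPerms [[2, 3, 1], [4, 1, 2, 3]] n ↔
      (∀ i j k, i < j → j < k → σ k < σ i → σ j ≤ σ i) ∧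
      ∀ i j k l, i < j → j < k → k < l → σ j < σ k → σ k < σ l → σ i ≤ σ l := by
  simp [avoidingPerms, AvoidsPatterns, containsPattern_231_iff, containsPattern_4123_iff]
  grind

section Sites

variable {n : ℕ} (σ : Equiv.Perm (Fin n)) (p : Fin (n + 1))

/-- A site at or to the left of `p` keeps its number, since only entries from `p` onwards are
shifted. -/
theorem val_succAbove_lt_iff {q : ℕ} (hq : q ≤ p) (i : Fin n) :
    (p.succAbove i : ℕ) < q ↔ (i : ℕ) < q := by
  rw [Fin.succAbove]
  split_ifs with h
  · simp
  · simp only [Fin.lt_def, Fin.val_castSucc, Fin.val_succ] at *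
    omega

theorem le_val_succAbove_iff {q : ℕ} (hq : q ≤ p) (i : Fin n) :
    q ≤ (p.succAbove i : ℕ) ↔ q ≤ (i : ℕ) := by
  simpa using (val_succAbove_lt_iff p hq i).not

theorem succAbove_lt_iff_val (i : Fin n) : p.succAbove i < p ↔ (i : ℕ) < p := by
  rw [Fin.succAbove_lt_iff_castSucc_lt, Fin.lt_def, Fin.val_castSucc]

theorem lt_succAbove_iff_val (i : Fin n) : p < p.succAbove i ↔ p ≤ (i : ℕ) := by
  rw [Fin.lt_succAbove_iff_le_castSucc, Fin.le_def, Fin.val_castSucc]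

theorem insertMax_mem_iff :
    insertMax σ p ∈ avoidingPerms [[2, 3, 1], [4, 1, 2, 3]] (n + 1) ↔
      σ ∈ avoidingPerms [[2, 3, 1], [4, 1, 2, 3]] n ∧ IsActiveSite σ p := by
  have hc : ∀ x : Fin n, ¬ Fin.last n < x.castSucc := fun x => (Fin.le_last _).not_gt
  have hc' : ∀ x : Fin n, ¬ Fin.last n ≤ x.castSucc := fun x => (Fin.castSucc_lt_last x).not_ge
  rw [mem_avoidingPerms_iff, mem_avoidingPerms_iff, isActiveSite_iff]
  simp only [Fin.forall_iff_succAbove p, insertMax_self, insertMax_succAbove, lt_self_iff_false,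
    Fin.succAbove_lt_succAbove_iff, Fin.castSucc_lt_castSucc_iff, Fin.castSucc_le_castSucc_iff,
    succAbove_lt_iff_val, lt_succAbove_iff_val, Fin.castSucc_lt_last, hc, hc', Fin.le_last,
    false_imp_iff, imp_true_iff, and_true, true_and, le_refl]
  have hp := p.is_le
  constructor
  · rintro ⟨h1, h2⟩
    grind
  · rintro ⟨⟨h1, h2⟩, h3, h4, h5⟩
    grind

/-- A site to the right of the new maximum, other than the end, has that maximum before a smaller
entry. For a site `q ≤ p` the only new danger is a 123 ending in the new maximum, that is, an
ascending pair between `q` and `p`. -/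
theorem isActiveSite_insertMax_iff (q : ℕ) :
    IsActiveSite (insertMax σ p) q ↔
      q = n + 1 ∨ (q ≤ p ∧ IsActiveSite σ q ∧ IsDecreasingOn σ q p) := by
  have hc : ∀ x : Fin n, ¬ Fin.last n < x.castSucc := fun x => (Fin.le_last _).not_gt
  have hc' : ∀ x : Fin n, ¬ Fin.last n ≤ x.castSucc := fun x => (Fin.castSucc_lt_last x).not_ge
  have hp := p.is_le
  by_cases hq : q ≤ p
  · rw [isActiveSite_iff, isActiveSite_iff, IsDecreasingOn]
    simp only [Fin.forall_iff_succAbove p, insertMax_self, insertMax_succAbove, lt_self_iff_false,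
      Fin.succAbove_lt_succAbove_iff, Fin.castSucc_lt_castSucc_iff, Fin.castSucc_le_castSucc_iff,
      succAbove_lt_iff_val, lt_succAbove_iff_val, hc, hc', Fin.le_last,
      val_succAbove_lt_iff p hq, le_val_succAbove_iff p hq, hq, hq.not_gt,
      false_imp_iff, true_imp_iff, imp_true_iff, and_true, true_and, le_refl, imp_false]
    constructor
    · rintro ⟨h1, h2, h3⟩
      grind
    · rintro (h | ⟨⟨h0, h1, h2⟩, h3⟩)
      · omega
      · grind
  · constructor
    · intro h
      by_contra hne
      have hle := h.le
      have := h.cut p ⟨q, by omega⟩ (by omega) le_rfl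
      rw [insertMax_self] at this
      have := (insertMax σ p).injective (((Fin.le_last _).antisymm this).trans
        (insertMax_self σ p).symm)
      exact hq (Fin.ext_iff.1 this).le
    · rintro (rfl | h)
      · exact ⟨le_rfl, fun i j _ _ => by omega, fun i j k _ _ _ _ => by omega⟩
      · exact absurd h.1 hq

theorem isDecreasingOn_insertMax_iff {q : ℕ} (hq : q ≤ p) :
    IsDecreasingOn (insertMax σ p) q p ↔ IsDecreasingOn σ q p := by
  rw [IsDecreasingOn, IsDecreasingOn]
  simp only [Fin.forall_iff_succAbove p, insertMax_self, insertMax_succAbove, lt_self_iff_false,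
    Fin.succAbove_lt_succAbove_iff, Fin.castSucc_le_castSucc_iff,
    lt_succAbove_iff_val, Fin.le_last, val_succAbove_lt_iff p le_rfl,
    le_val_succAbove_iff p hq, hq, false_imp_iff, imp_true_iff, true_and]

theorem isDecreasingOn_insertMax_self_iff :
    IsDecreasingOn (insertMax σ p) p (n + 1) ↔ IsDecreasingOn σ p n := by
  rw [IsDecreasingOn, IsDecreasingOn]
  simp only [Fin.forall_iff_succAbove p, insertMax_self, insertMax_succAbove, lt_self_iff_false,
    Fin.succAbove_lt_succAbove_iff, Fin.castSucc_le_castSucc_iff, Fin.is_lt,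
    succAbove_lt_iff_val, lt_succAbove_iff_val, Fin.le_last,
    le_val_succAbove_iff p le_rfl]
  grind

theorem isDecreasingOn_of_le {q r : ℕ} (h : r ≤ q + 1) : IsDecreasingOn σ q r :=
  fun i j _ hij _ => by rw [Fin.lt_def] at hij; omega

variable {σ} in
-- Entries to the left of an active site are smaller than those to its right, so a stretch crossing
-- it contains an ascending pair.
theorem IsActiveSite.not_isDecreasingOn {q r s : ℕ} (h : IsActiveSite σ q) (hr : r < q)
    (hs : q < s) (hq : q < n) : ¬ IsDecreasingOn σ r s := by
  intro hd
  have h1 := h.cut ⟨r, by omega⟩ ⟨q, hq⟩ hr le_rfl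
  have h2 := hd ⟨r, by omega⟩ ⟨q, hq⟩ le_rfl hr hs
  exact hr.ne (Fin.ext_iff.1 (σ.injective (h1.antisymm h2)))

end Sites

/-! ### The four states of a permutation -/

/-- The shape of the active sites of a permutation with the given label. -/
def PermState {n : ℕ} (σ : Equiv.Perm (Fin n)) (l : TreeLabel) : Prop :=
  match l with
  | .l0 => 0 < n ∧ IsDecreasingOn σ 0 n ∧ ∀ q, IsActiveSite σ q ↔ q = 0 ∨ q = n
  | .l01 => ∃ r s, r < s ∧ s < n ∧ IsDecreasingOn σ r s ∧ IsDecreasingOn σ s n ∧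
      ∀ q, IsActiveSite σ q ↔ q = r ∨ q = s ∨ q = n
  | .l010 => ∃ s, s < n ∧ ¬ IsDecreasingOn σ s n ∧ ∀ q, IsActiveSite σ q ↔ q = s ∨ q = n
  | .l0102 => ∃ s, 0 < s ∧ s < n ∧ IsDecreasingOn σ s n ∧ ∀ q, IsActiveSite σ q ↔ q = s ∨ q = n

open Classical in
/-- The label of a permutation that avoids `231` and `4123`. -/
noncomputable def permLabel {n : ℕ} (σ : Equiv.Perm (Fin n)) : TreeLabel :=
  if IsDecreasingOn σ 0 n then .l0
  else if ∃ q r, q < r ∧ r < n ∧ IsActiveSite σ q ∧ IsActiveSite σ r then .l01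
  else if ∃ q, q < n ∧ IsActiveSite σ q ∧ ¬ IsDecreasingOn σ q n then .l010
  else .l0102

theorem PermState.permLabel_eq {n : ℕ} {σ : Equiv.Perm (Fin n)} {l : TreeLabel}
    (h : PermState σ l) : permLabel σ = l := by
  match l with
  | .l0 => exact if_pos h.2.1
  | .l01 =>
    obtain ⟨r, s, hrs, hs, -, -, ha⟩ := h
    rw [permLabel, if_neg (((ha s).2 (by simp)).not_isDecreasingOn (by omega) hs hs), if_pos]
    exact ⟨r, s, hrs, hs, (ha r).2 (by simp), (ha s).2 (by simp)⟩
  | .l010 =>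
    obtain ⟨s, hs, hd, ha⟩ := h
    rw [permLabel, if_neg fun h => hd fun i j _ => h i j (Nat.zero_le _), if_neg, if_pos]
    · exact ⟨s, hs, (ha s).2 (by simp), hd⟩
    · simp only [ha]
      omega
  | .l0102 =>
    obtain ⟨s, hs0, hs, hd, ha⟩ := h
    rw [permLabel, if_neg (((ha s).2 (by simp)).not_isDecreasingOn hs0 hs hs), if_neg, if_neg]
    · rintro ⟨q, hq, hq', hq''⟩
      rw [ha] at hq'
      obtain rfl : q = s := by omega
      exact hq'' hd
    · simp only [ha]
      omega

theorem exists_unique_parent_permTree (n : ℕ)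
    (w : (permTree [[2, 3, 1], [4, 1, 2, 3]]).Node (n + 1)) :
    ∃! v, (permTree [[2, 3, 1], [4, 1, 2, 3]]).IsChild v w := by
  obtain ⟨τ, hτ⟩ := w
  obtain ⟨σ, p, rfl⟩ := exists_eq_insertMax τ
  refine ⟨⟨σ, ((insertMax_mem_iff σ p).1 hτ).1⟩, (isMaxInsertion_iff σ _).2 ⟨p, rfl⟩, ?_⟩
  rintro ⟨σ', hσ'⟩ h
  obtain ⟨p', h⟩ := (isMaxInsertion_iff σ' _).1 h
  exact Subtype.ext (insertMax_inj.1 h).1.symm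

theorem exists_children_permTree {n : ℕ} (v : (permTree [[2, 3, 1], [4, 1, 2, 3]]).Node n)
    (A : List (Fin (n + 2))) (hA : A.Nodup) (hv : ∀ p : Fin (n + 2), IsActiveSite v.1 p ↔ p ∈ A)
    (hQ : ∀ p ∈ A, ∃ l, PermState (insertMax v.1 p) l) :
    ∃ L : List ((permTree [[2, 3, 1], [4, 1, 2, 3]]).Node (n + 1)), L.Nodup ∧
      (∀ w, (permTree [[2, 3, 1], [4, 1, 2, 3]]).IsChild v w ↔ w ∈ L) ∧
      (∀ w ∈ L, PermState w.1 (permLabel w.1)) ∧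
      L.map (fun w => permLabel w.1) = A.map fun p => permLabel (insertMax v.1 p) := by
  have hmem : ∀ p ∈ A, insertMax v.1 p ∈ avoidingPerms [[2, 3, 1], [4, 1, 2, 3]] (n + 2) :=
    fun a ha => (insertMax_mem_iff _ _).2 ⟨v.2, (hv a).2 ha⟩
  refine ⟨A.pmap (fun p hp => ⟨insertMax v.1 p, hp⟩) hmem, ?_, ?_, ?_, ?_⟩
  · refine hA.pmap fun a _ b _ hab => ?_
    exact (insertMax_inj.1 (Subtype.ext_iff.1 hab)).2
  · rintro ⟨w, hw⟩
    refine Iff.trans ?_ List.mem_pmap.symm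
    refine (isMaxInsertion_iff v.1 w).trans ?_
    constructor
    · rintro ⟨p, rfl⟩
      exact ⟨p, (hv p).1 ((insertMax_mem_iff _ _).1 hw).2, rfl⟩
    · rintro ⟨p, _, hp⟩
      exact ⟨p, (Subtype.ext_iff.1 hp).symm⟩
  · intro w hw
    obtain ⟨p, hp, rfl⟩ := List.mem_pmap.1 hw
    obtain ⟨l, h⟩ := hQ p hp
    change PermState (insertMax v.1 p) (permLabel (insertMax v.1 p))
    rwa [h.permLabel_eq]
  · exact (List.map_pmap ..).trans
      (List.pmap_eq_map (f := fun p => permLabel (insertMax v.1 p)) hmem)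

namespace PermState

variable {n : ℕ} {σ : Equiv.Perm (Fin n)}

/-- The hypotheses make `s` the only active site below `n` from which the entries decrease to the
end. It survives together with `n` and the new end `n + 1`. Three of the four states are of this
kind. -/
theorem insertMax_last_of_decreasing {s : ℕ} (hs : s < n) (hd : IsDecreasingOn σ s n)
    (ha : ∀ q, IsActiveSite σ q → q ≠ n → s < q ∨ q = s ∨ ¬ IsDecreasingOn σ q n)
    (ha' : ∀ q, IsActiveSite σ q → q ≤ s ∨ q = n) (has : IsActiveSite σ s)
    (han : IsActiveSite σ n) : PermState (insertMax σ (Fin.last n)) .l01 := by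
  refine ⟨s, n, hs, n.lt_succ_self, ?_, isDecreasingOn_of_le _ le_rfl, fun q => ?_⟩
  · exact (isDecreasingOn_insertMax_iff σ (Fin.last n) hs.le).2 hd
  · rw [isActiveSite_insertMax_iff, Fin.val_last]
    constructor
    · rintro (h | ⟨h1, h2, h3⟩)
      · exact .inr (.inr h)
      · have h4 := ha q h2
        have h5 := ha' q h2
        by_cases hq : q = n
        · exact .inr (.inl hq)
        · rcases h4 hq with h | h | h
          · omega
          · exact .inl h
          · exact absurd h3 h
    · rintro (rfl | rfl | rfl)
      · exact .inr ⟨hs.le, has, hd⟩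
      · exact .inr ⟨le_rfl, han, isDecreasingOn_of_le _ (Nat.le_succ _)⟩
      · exact .inl rfl

theorem insertMax_last_l0 (h : PermState σ .l0) : PermState (insertMax σ (Fin.last n)) .l01 := by
  obtain ⟨hn, hd, ha⟩ := h
  exact insertMax_last_of_decreasing hn hd (fun q hq hqn => by rw [ha] at hq; omega)
    (fun q hq => by rw [ha] at hq; omega) ((ha 0).2 (by simp)) ((ha n).2 (by simp))

theorem insertMax_zero_l0 (h : PermState σ .l0) : PermState (insertMax σ 0) .l0 := by
  obtain ⟨hn, hd, ha⟩ := h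
  refine ⟨n.succ_pos, (isDecreasingOn_insertMax_self_iff σ 0).2 hd, fun q => ?_⟩
  rw [isActiveSite_insertMax_iff, ha]
  constructor
  · rintro (h | ⟨h1, -, -⟩)
    · exact .inr h
    · exact .inl (by simpa using h1)
  · rintro (rfl | h)
    · exact .inr ⟨le_rfl, .inl rfl, isDecreasingOn_of_le _ (Nat.zero_le _)⟩
    · exact .inl h

theorem insertMax_last_l01 (h : PermState σ .l01) : PermState (insertMax σ (Fin.last n)) .l01 := by
  obtain ⟨r, s, hrs, hs, hd, hd', ha⟩ := h
  have has := (ha s).2 (by simp)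
  refine insertMax_last_of_decreasing hs hd' (fun q hq hqn => ?_)
    (fun q hq => by rw [ha] at hq; omega) has ((ha n).2 (by simp))
  rw [ha] at hq
  rcases hq with rfl | rfl | rfl
  · exact .inr (.inr (has.not_isDecreasingOn hrs hs hs))
  · exact .inr (.inl rfl)
  · exact absurd rfl hqn

theorem insertMax_last_l0102 (h : PermState σ .l0102) :
    PermState (insertMax σ (Fin.last n)) .l01 := by
  obtain ⟨s, -, hs, hd, ha⟩ := h
  exact insertMax_last_of_decreasing hs hd (fun q hq hqn => by rw [ha] at hq; omega)
    (fun q hq => by rw [ha] at hq; omega) ((ha s).2 (by simp)) ((ha n).2 (by simp))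

/-- The ascending pair after `s` and the new final maximum form a 123, so `s` dies and `n` takes its
place. -/
theorem insertMax_last_l010 (h : PermState σ .l010) :
    PermState (insertMax σ (Fin.last n)) .l0102 := by
  obtain ⟨s, hs, hd, ha⟩ := h
  refine ⟨n, by omega, n.lt_succ_self, isDecreasingOn_of_le _ le_rfl, fun q => ?_⟩
  rw [isActiveSite_insertMax_iff, Fin.val_last, ha]
  constructor
  · rintro (h | ⟨-, rfl | h, h3⟩)
    · exact .inr h
    · exact absurd h3 hd
    · exact .inl h
  · rintro (rfl | h)
    · exact .inr ⟨le_rfl, .inr rfl, isDecreasingOn_of_le _ (Nat.le_succ _)⟩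
    · exact .inl h

/-- Insertion at the leftmost active site leaves only that site and the new end. -/
theorem isActiveSite_insertMax_iff_of_forall {p : Fin (n + 1)} (hp : IsActiveSite σ p)
    (h : ∀ q, IsActiveSite σ q → (p : ℕ) ≤ q) (q : ℕ) :
    IsActiveSite (insertMax σ p) q ↔ q = p ∨ q = n + 1 := by
  rw [isActiveSite_insertMax_iff]
  constructor
  · rintro (h1 | ⟨h1, h2, h3⟩)
    · exact .inr h1
    · exact .inl (h1.antisymm (h q h2))
  · rintro (rfl | h)
    · exact .inr ⟨le_rfl, hp, isDecreasingOn_of_le _ (Nat.le_succ _)⟩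
    · exact .inl h

theorem insertMax_l010 {p : Fin (n + 1)} (h : PermState σ .l010) (hp : IsActiveSite σ p)
    (hpn : p ≠ Fin.last n) : PermState (insertMax σ p) .l010 := by
  obtain ⟨s, hs, hd, ha⟩ := h
  have hpn' : (p : ℕ) ≠ n := fun h => hpn (Fin.ext h)
  obtain rfl : (p : ℕ) = s := by rw [ha] at hp; omega
  exact ⟨p, p.is_lt, fun h => hd ((isDecreasingOn_insertMax_self_iff σ p).1 h),
    isActiveSite_insertMax_iff_of_forall hp fun q hq => by rw [ha] at hq; omega⟩

theorem insertMax_l0102 {p : Fin (n + 1)} (h : PermState σ .l0102) (hp : IsActiveSite σ p)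
    (hpn : p ≠ Fin.last n) : PermState (insertMax σ p) .l0102 := by
  obtain ⟨s, hs0, hs, hd, ha⟩ := h
  have hpn' : (p : ℕ) ≠ n := fun h => hpn (Fin.ext h)
  obtain rfl : (p : ℕ) = s := by rw [ha] at hp; omega
  exact ⟨p, hs0, p.is_lt, (isDecreasingOn_insertMax_self_iff σ p).2 hd,
    isActiveSite_insertMax_iff_of_forall hp fun q hq => by rw [ha] at hq; omega⟩

theorem insertMax_l01_of_forall_le {p : Fin (n + 1)} (h : PermState σ .l01)
    (hp : IsActiveSite σ p) (hle : ∀ q, IsActiveSite σ q → (p : ℕ) ≤ q) :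
    PermState (insertMax σ p) .l010 := by
  obtain ⟨r, s, hrs, hs, hd, hd', ha⟩ := h
  have hps := hle r ((ha r).2 (by simp))
  refine ⟨p, p.is_lt, fun h => ?_, isActiveSite_insertMax_iff_of_forall hp hle⟩
  rw [isDecreasingOn_insertMax_self_iff] at h
  -- Here `p ≤ r < s`, so the tail from `p` crosses the active site `s` and cannot decrease.
  exact ((ha s).2 (by simp)).not_isDecreasingOn (by omega) hs hs h

end PermState

theorem one_mem_avoidingPerms : 1 ∈ avoidingPerms [[2, 3, 1], [4, 1, 2, 3]] 1 := by
  rw [mem_avoidingPerms_iff]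
  exact ⟨fun i j k hij => by omega, fun i j k l hij => by omega⟩

theorem permState_one : PermState (1 : Equiv.Perm (Fin 1)) .l0 := by
  refine ⟨one_pos, fun i j _ hij => by omega, fun q => ?_⟩
  rw [isActiveSite_iff]
  constructor
  · intro h
    omega
  · intro h
    exact ⟨by omega, fun i j _ _ => by omega, fun i j k _ hij => by omega⟩

theorem isGeneratingTree_permTree :
    IsGeneratingTree (permTree [[2, 3, 1], [4, 1, 2, 3]]) fourLabelRules
      fun _ v => permLabel v.1 := by
  refine IsGeneratingTree.of_relation (fun n v l => PermState v.1 l)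
    (fun n v l h => h.permLabel_eq) ?_ exists_unique_parent_permTree ?_
  · refine ⟨⟨1, one_mem_avoidingPerms⟩, permState_one, ?_⟩
    rintro ⟨s, hs⟩
    exact Subtype.ext (Subsingleton.elim (α := Equiv.Perm (Fin 1)) s 1)
  · rintro n v l h
    match l with
    | .l0 =>
      obtain ⟨-, -, ha⟩ := id h
      obtain ⟨L, h1, h2, h3, h4⟩ := exists_children_permTree v [0, Fin.last (n + 1)]
        (by simp [Fin.ext_iff]) (fun p => by
          rw [ha, List.mem_pair, Fin.ext_iff, Fin.ext_iff, Fin.val_zero, Fin.val_last])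
        (by simpa using ⟨⟨_, h.insertMax_zero_l0⟩, _, h.insertMax_last_l0⟩)
      refine ⟨L, h1, h2, h3, ?_⟩
      rw [h4, List.map_cons, List.map_cons, h.insertMax_zero_l0.permLabel_eq,
        h.insertMax_last_l0.permLabel_eq]
      rfl
    | .l01 =>
      obtain ⟨r, s, hrs, hs, hd, hd', ha⟩ := id h
      let p : Fin (n + 2) := ⟨r, by omega⟩
      let p' : Fin (n + 2) := ⟨s, by omega⟩
      have hp : PermState (insertMax v.1 p) .l010 := h.insertMax_l01_of_forall_le
        ((ha r).2 (by simp)) fun q hq => by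
          rw [ha] at hq
          change r ≤ q
          omega
      -- Insertion at the middle site keeps `r`, because the stretch from `r` to `s` decreases; the
      -- tail from `s` still decreases with the maximum in front.
      have hp' : PermState (insertMax v.1 p') .l01 := by
        refine ⟨r, s, hrs, by omega, (isDecreasingOn_insertMax_iff v.1 p' hrs.le).2 hd,
          (isDecreasingOn_insertMax_self_iff v.1 p').2 hd', fun q => ?_⟩
        rw [isActiveSite_insertMax_iff, ha]
        change q = n + 1 + 1 ∨ q ≤ s ∧ _ ∧ IsDecreasingOn _ q s ↔ _
        constructor
        · omega
        · rintro (rfl | rfl | rfl)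
          · exact .inr ⟨hrs.le, .inl rfl, hd⟩
          · exact .inr ⟨le_rfl, .inr (.inl rfl), isDecreasingOn_of_le _ (Nat.le_succ _)⟩
          · exact .inl rfl
      obtain ⟨L, h1, h2, h3, h4⟩ := exists_children_permTree v [Fin.last (n + 1), p', p]
        (by simp [Fin.ext_iff, p, p']; omega)
        (fun q => by rw [ha]; simp [Fin.ext_iff, p, p']; omega)
        (by simpa using ⟨⟨_, h.insertMax_last_l01⟩, ⟨_, hp'⟩, _, hp⟩)
      refine ⟨L, h1, h2, h3, ?_⟩
      rw [h4, List.map_cons, List.map_cons, List.map_cons, h.insertMax_last_l01.permLabel_eq,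
        hp.permLabel_eq, hp'.permLabel_eq]
      rfl
    | .l010 =>
      obtain ⟨s, hs, hd, ha⟩ := id h
      let p : Fin (n + 2) := ⟨s, by omega⟩
      have hp := h.insertMax_l010 (p := p) ((ha s).2 (by simp))
        (fun h => hs.ne (Fin.ext_iff.1 h))
      obtain ⟨L, h1, h2, h3, h4⟩ := exists_children_permTree v [p, Fin.last (n + 1)]
        (by simp [Fin.ext_iff, p]; omega) (fun q => by rw [ha]; simp [Fin.ext_iff, p])
        (by simpa using ⟨⟨_, hp⟩, _, h.insertMax_last_l010⟩)
      refine ⟨L, h1, h2, h3, ?_⟩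
      rw [h4, List.map_cons, List.map_cons, hp.permLabel_eq, h.insertMax_last_l010.permLabel_eq]
      rfl
    | .l0102 =>
      obtain ⟨s, hs0, hs, hd, ha⟩ := id h
      let p : Fin (n + 2) := ⟨s, by omega⟩
      have hp := h.insertMax_l0102 (p := p) ((ha s).2 (by simp))
        (fun h => hs.ne (Fin.ext_iff.1 h))
      obtain ⟨L, h1, h2, h3, h4⟩ := exists_children_permTree v [Fin.last (n + 1), p]
        (by simp [Fin.ext_iff, p]; omega) (fun q => by rw [ha]; simp [Fin.ext_iff, p]; omega)
        (by simpa using ⟨⟨_, h.insertMax_last_l0102⟩, _, hp⟩)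
      refine ⟨L, h1, h2, h3, ?_⟩
      rw [h4, List.map_cons, List.map_cons, hp.permLabel_eq, h.insertMax_last_l0102.permLabel_eq]
      rfl

/-! ### Length zero and the conclusion -/

theorem card_avoidingAscentSeqs_zero :
    Nat.card (avoidingAscentSeqs [[1, 0, 1], [1, 2, 0]] 0) = 1 := by
  rw [Nat.card_eq_one_iff_unique]
  refine ⟨inferInstance, ⟨![], (mem_avoidingAscentSeqs_iff _).2 ⟨?_, ?_, ?_⟩⟩⟩ <;>
    exact fun i => i.elim0

theorem card_avoidingPerms_zero :
    Nat.card (avoidingPerms [[2, 3, 1], [4, 1, 2, 3]] 0) = 1 := by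
  rw [Nat.card_eq_one_iff_unique]
  refine ⟨inferInstance, ⟨1, (mem_avoidingPerms_iff _).2 ⟨?_, ?_⟩⟩⟩ <;>
    exact fun i => i.elim0

theorem mainTheorem5 :
    (∀ n : ℕ, Nonempty
      (avoidingAscentSeqs [[1, 0, 1], [1, 2, 0]] n ≃
        avoidingPerms [[2, 3, 1], [4, 1, 2, 3]] n)) ∧
    (∃ (labA : (ascentTree [[1, 0, 1], [1, 2, 0]]).Labelling TreeLabel)
       (labP : (permTree [[2, 3, 1], [4, 1, 2, 3]]).Labelling TreeLabel),
      IsGeneratingTree (ascentTree [[1, 0, 1], [1, 2, 0]]) fourLabelRules labA ∧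
      IsGeneratingTree (permTree [[2, 3, 1], [4, 1, 2, 3]]) fourLabelRules labP ∧
      (∃ x : avoidingAscentSeqs [[1, 0, 1], [1, 2, 0]] 1,
        x.1 = ![0] ∧ labA 0 x = TreeLabel.l0) ∧
      (∃ x : avoidingAscentSeqs [[1, 0, 1], [1, 2, 0]] 2,
        x.1 = ![0, 1] ∧ labA 1 x = TreeLabel.l01) ∧
      (∃ x : avoidingAscentSeqs [[1, 0, 1], [1, 2, 0]] 3,
        x.1 = ![0, 1, 0] ∧ labA 2 x = TreeLabel.l010) ∧
      (∃ x : avoidingAscentSeqs [[1, 0, 1], [1, 2, 0]] 4,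
        x.1 = ![0, 1, 0, 2] ∧ labA 3 x = TreeLabel.l0102) ∧
      Nonempty (LabelledIso (ascentTree [[1, 0, 1], [1, 2, 0]])
        (permTree [[2, 3, 1], [4, 1, 2, 3]]) labA labP)) ∧
    (PowerSeries.mk fun n =>
        (Nat.card (avoidingAscentSeqs [[1, 0, 1], [1, 2, 0]] n) : ℚ)) =
      (PowerSeries.X - 1) ^ 3 *
        (3 * PowerSeries.X ^ 3 - 5 * PowerSeries.X ^ 2 + 4 * PowerSeries.X - 1)⁻¹ ∧
    (PowerSeries.mk fun n =>
        (Nat.card (avoidingPerms [[2, 3, 1], [4, 1, 2, 3]] n) : ℚ)) =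
      (PowerSeries.X - 1) ^ 3 *
        (3 * PowerSeries.X ^ 3 - 5 * PowerSeries.X ^ 2 + 4 * PowerSeries.X - 1)⁻¹ := by
  obtain ⟨e⟩ := isGeneratingTree_ascentTree.nonempty_labelledIso isGeneratingTree_permTree
  refine ⟨fun n => ?_, ⟨_, _, isGeneratingTree_ascentTree, isGeneratingTree_permTree,
    exists_ascentLabel_eq.1, exists_ascentLabel_eq.2.1, exists_ascentLabel_eq.2.2.1,
    exists_ascentLabel_eq.2.2.2, ⟨e⟩⟩,
    powerSeries_eq_of_fourLabelRules isGeneratingTree_ascentTree _ card_avoidingAscentSeqs_zero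
      fun _ => rfl,
    powerSeries_eq_of_fourLabelRules isGeneratingTree_permTree _ card_avoidingPerms_zero
      fun _ => rfl⟩
  -- Level `n` of the trees holds the objects of length `n + 1`, so the empty word is treated apart.
  match n with
  | 0 =>
    exact Finite.card_eq.1 (card_avoidingAscentSeqs_zero.trans card_avoidingPerms_zero.symm)
  | n + 1 => exact ⟨e.toEquiv n⟩
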